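/- For finite graphs $H_1, H_2$, let $r(H_1,H_2)$ denote the smallest positive integer $N$ such that every graph $G$ on $N$ vertices contains $H_1$ as a (not necessarily induced) subgraph or its complement $\overline{G}$ contains $H_2$ as a subgraph. Let $C_m$ denote the cycle with $m$ vertices. Then for every odd integer $k\ge 3$ and every integer $n\ge 1833k^4$, $$r(C_n,C_k)=2n-1.$$ -/

import Mathlib

/-- `RamseyProperty H₁ H₂ N`: every graph on `N` vertices contains `H₁` as a (not necessarily
induced) subgraph, or its complement contains `H₂` as a subgraph. -/
def RamseyProperty {V W : Type*} (H₁ : SimpleGraph V) (H₂ : SimpleGraph W) (N : ℕ) : Prop :=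
  ∀ G : SimpleGraph (Fin N), H₁.IsContained G ∨ H₂.IsContained Gᶜ

/-- `IsRamseyNumber H₁ H₂ N` says that `r(H₁, H₂)` exists and equals `N`, that is, `N` is the
smallest positive integer with the Ramsey property for `H₁` and `H₂`. -/
def IsRamseyNumber {V W : Type*} (H₁ : SimpleGraph V) (H₂ : SimpleGraph W) (N : ℕ) : Prop :=
  IsLeast {M : ℕ | 0 < M ∧ RamseyProperty H₁ H₂ M} N

open SimpleGraph

/-! Lower bound: two disjoint cliques on at most `n - 1` vertices each contain no `C_n`, and their
complement is bipartite, so it has no odd cycle.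

Upper bound: let `G` have `2n - 1` vertices and suppose `Gᶜ` has no `C_k`; then every `k`-set spans
an edge of `G`. There are two cases.

If any two disjoint `k`-sets are joined by an edge of `G`, greedily pick about `n/2` disjoint
triangles, link most of them into a chain by depth first search, and close it up. Each triangle may
contribute two or three vertices, which tunes the length to exactly `n`
(`cycleGraph_isContained_of_joined`).

Otherwise some disjoint `k`-sets `A`, `B` are completely joined in `Gᶜ`. A vertex with
`Gᶜ`-neighbours in both would close an odd cycle `C_k`, so `A` and `B` are cliques of `G` and every
other vertex is `G`-adjacent to all of `A` or to all of `B`. One side then has `n` vertices, and its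
clique strings a path cover of the rest into `C_n` (`cycleGraph_isContained_of_not_joined`).

The upper bound only needs `n ≥ 50k²`. -/

/-! ### Cycles as closed lists -/

theorem SimpleGraph.cycleGraph_isContained_of_list {V : Type*} {G : SimpleGraph V} {n : ℕ}
    {l : List V} (hl : l.length = n) (hnd : l.Nodup) (hc : l.IsChain G.Adj)
    (hclose : ∀ x ∈ l.head?, ∀ y ∈ l.getLast?, G.Adj y x) : (cycleGraph n).IsContained G := by
  subst hl
  have step : ∀ u v : Fin l.length, (v - u).val = 1 → G.Adj (l.get u) (l.get v) := by
    intro u v h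
    have hpos : 0 < l.length := u.pos
    rw [Fin.sub_def] at h
    simp only at h
    rcases Nat.lt_or_ge u.val v.val with huv | huv
    · have h1 : v.val = u.val + 1 := by
        rw [show l.length - u.val + v.val = (v.val - u.val) + l.length by omega,
          Nat.add_mod_right, Nat.mod_eq_of_lt (by omega)] at h
        omega
      have := List.isChain_iff_getElem.1 hc u.val (by omega)
      simpa [h1] using this
    · rcases Nat.eq_or_lt_of_le huv with he | hlt
      · rw [he, Nat.sub_add_cancel u.2.le, Nat.mod_self] at h
        omega
      · rw [Nat.mod_eq_of_lt (by omega)] at h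
        -- The wrap-around: a cyclic successor with smaller index goes from last to first.
        have hu : u.val = l.length - 1 := by omega
        have hv : v.val = 0 := by omega
        have hne : l ≠ [] := List.ne_nil_of_length_pos hpos
        have := hclose (l.head hne) (by simp [List.head?_eq_some_head hne]) (l.getLast hne)
          (by simp [List.getLast?_eq_some_getLast hne])
        simpa [List.getLast_eq_getElem, List.head_eq_getElem, hu, hv] using this
  refine ⟨⟨⟨l.get, ?_⟩, List.nodup_iff_injective_get.1 hnd⟩⟩
  intro u v h
  rcases cycleGraph_adj'.1 h with h | h
  · exact (step v u h).symm
  · exact step u v h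

/-! ### The well-joined case: chains of triangles -/

/-- Depth first search. -/
theorem exists_long_chain_of_joined {α : Type*} [DecidableEq α] (R : α → α → Prop) (S : Finset α)
    (k : ℕ) (hR : ∀ X ⊆ S, ∀ Y ⊆ S, Disjoint X Y → X.card = k → Y.card = k →
      ∃ x ∈ X, ∃ y ∈ Y, R x y) :
    ∃ l : List α, l.IsChain R ∧ l.Nodup ∧ (∀ a ∈ l, a ∈ S) ∧ S.card ≤ l.length + 2 * k := by
  -- `P` is the stack, `U` the unvisited and `D` the abandoned elements. Each move, pushing from `U`
  -- or popping into `D`, lowers `|U| - |D| = m` by one. At `m = 0` the sets `U` and `D` have equal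
  -- size with no `R` between them, so both are small.
  have key : ∀ m d : ℕ, m + d = S.card → ∃ (P : List α) (U D : Finset α), P.IsChain R ∧ P.Nodup ∧
      (∀ a ∈ P, a ∈ S ∧ a ∉ U ∧ a ∉ D) ∧ U ⊆ S ∧ D ⊆ S ∧ Disjoint U D ∧
      P.length + U.card + D.card = S.card ∧ U.card = D.card + m ∧ ∀ u ∈ U, ∀ d ∈ D, ¬ R u d := by
    intro m d
    induction d generalizing m with
    | zero => intro h; exact ⟨[], S, ∅, by simp, by simp, by simp, by simp, by simp, by simp, by simp,
        by simp; omega, by simp⟩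
    | succ d ih =>
      intro h
      obtain ⟨P, U, D, hc, hnd, hP, hU, hD, hdis, hcard, hUD, hno⟩ := ih (m + 1) (by omega)
      have extend : ∀ u ∈ U, (u :: P).IsChain R → ∃ (P : List α) (U D : Finset α), P.IsChain R ∧
          P.Nodup ∧ (∀ a ∈ P, a ∈ S ∧ a ∉ U ∧ a ∉ D) ∧ U ⊆ S ∧ D ⊆ S ∧ Disjoint U D ∧
          P.length + U.card + D.card = S.card ∧ U.card = D.card + m ∧
          ∀ u ∈ U, ∀ d ∈ D, ¬ R u d := by
        intro u hu hch
        have hc1 := Finset.card_erase_add_one hu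
        refine ⟨u :: P, U.erase u, D, hch, ?_, ?_, (Finset.erase_subset _ _).trans hU, hD,
          Finset.disjoint_of_subset_left (Finset.erase_subset _ _) hdis, ?_, by omega,
          fun v hv => hno v (Finset.mem_of_mem_erase hv)⟩
        · exact List.nodup_cons.2 ⟨fun h => (hP u h).2.1 hu, hnd⟩
        · intro a ha
          rcases List.mem_cons.1 ha with rfl | ha
          · exact ⟨hU hu, by simp, Finset.disjoint_left.1 hdis hu⟩
          · exact ⟨(hP a ha).1, fun h => (hP a ha).2.1 (Finset.mem_of_mem_erase h), (hP a ha).2.2⟩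
        · simp only [List.length_cons]; omega
      cases P with
      | nil =>
        obtain ⟨u, hu⟩ := Finset.card_pos.1 (show 0 < U.card by omega)
        exact extend u hu (by simp)
      | cons p P =>
        by_cases hex : ∃ u ∈ U, R u p
        · obtain ⟨u, hu, hup⟩ := hex
          exact extend u hu (List.isChain_cons_cons.2 ⟨hup, hc⟩)
        · push Not at hex
          obtain ⟨hpS, hpU, hpD⟩ := hP p (by simp)
          have hc1 := Finset.card_insert_of_notMem hpD
          refine ⟨P, U, insert p D, hc.tail, hnd.tail, ?_, hU, ?_, ?_, ?_, by omega, ?_⟩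
          · intro a ha
            obtain ⟨h1, h2, h3⟩ := hP a (List.mem_cons_of_mem _ ha)
            refine ⟨h1, h2, ?_⟩
            rw [Finset.mem_insert, not_or]
            exact ⟨fun h => (List.nodup_cons.1 hnd).1 (h ▸ ha), h3⟩
          · exact Finset.insert_subset hpS hD
          · exact Finset.disjoint_insert_right.2 ⟨hpU, hdis⟩
          · simp only [List.length_cons] at hcard; omega
          · intro u hu d hd
            rcases Finset.mem_insert.1 hd with rfl | hd
            · exact hex u hu
            · exact hno u hu d hd
  obtain ⟨P, U, D, hc, hnd, hP, hU, hD, hdis, hcard, hUD, hno⟩ := key 0 S.card (by omega)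
  refine ⟨P, hc, hnd, fun a ha => (hP a ha).1, ?_⟩
  by_contra hlt
  obtain ⟨X, hX, hXc⟩ := Finset.exists_subset_card_eq (show k ≤ U.card by omega)
  obtain ⟨Y, hY, hYc⟩ := Finset.exists_subset_card_eq (show k ≤ D.card by omega)
  obtain ⟨x, hx, y, hy, hxy⟩ := hR X (hX.trans hU) Y (hY.trans hD)
    (Finset.disjoint_of_subset_left hX (Finset.disjoint_of_subset_right hY hdis)) hXc hYc
  exact hno x (hX hx) y (hY hy) hxy

/-- A vertex of large degree has an edge inside its neighbourhood. Otherwise delete it with its few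
neighbours: it extends any independent set found in the remainder. -/
theorem SimpleGraph.exists_triangle_of_sq_le_card {V : Type*} [DecidableEq V] {G : SimpleGraph V}
    (k : ℕ) (S : Finset V) (hS : k ^ 2 ≤ S.card)
    (hind : ∀ I ⊆ S, I.card = k → ∃ a ∈ I, ∃ b ∈ I, G.Adj a b) :
    ∃ x ∈ S, ∃ y ∈ S, ∃ z ∈ S, G.Adj x y ∧ G.Adj y z ∧ G.Adj x z := by
  classical
  induction k generalizing S with
  | zero => obtain ⟨a, ha, -⟩ := hind ∅ (by simp) (by simp); simp at ha
  | succ k ih =>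
    obtain ⟨v, hv⟩ := Finset.card_pos.1 (show 0 < S.card from lt_of_lt_of_le (by positivity) hS)
    by_cases hd : k + 1 ≤ (S.filter (G.Adj v)).card
    · obtain ⟨I, hI, hIc⟩ := Finset.exists_subset_card_eq hd
      obtain ⟨a, ha, b, hb, hab⟩ := hind I (hI.trans (Finset.filter_subset _ _)) hIc
      have ha' := Finset.mem_filter.1 (hI ha)
      have hb' := Finset.mem_filter.1 (hI hb)
      exact ⟨v, hv, a, ha'.1, b, hb'.1, ha'.2, hab, hb'.2⟩
    · have hsub : S.filter (G.Adj v) ⊆ S.erase v := fun x hx => by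
        have := Finset.mem_filter.1 hx
        exact Finset.mem_erase.2 ⟨this.2.ne', this.1⟩
      set T := S.erase v \ S.filter (G.Adj v) with hT
      have hTc : T.card = (S.erase v).card - (S.filter (G.Adj v)).card :=
        Finset.card_sdiff_of_subset hsub
      have hec := Finset.card_erase_add_one hv
      have hTS : T ⊆ S := Finset.sdiff_subset.trans (Finset.erase_subset _ _)
      have hTk : k ^ 2 ≤ T.card := by
        have : (k + 1) ^ 2 = k ^ 2 + 2 * k + 1 := by ring
        omega
      obtain ⟨x, hx, y, hy, z, hz, h⟩ := ih T hTk (by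
        intro I hI hIc
        have hvI : v ∉ I := fun h => by have := hI h; simp [hT] at this
        obtain ⟨a, ha, b, hb, hab⟩ := hind (insert v I)
          (Finset.insert_subset hv (hI.trans hTS)) (by rw [Finset.card_insert_of_notMem hvI, hIc])
        have hnv : ∀ c ∈ I, ¬ G.Adj v c := fun c hc h => by
          have := hI hc
          simp only [hT, Finset.mem_sdiff, Finset.mem_filter, not_and] at this
          exact this.2 (hTS (hI hc)) h
        rcases Finset.mem_insert.1 ha with rfl | haI
        · rcases Finset.mem_insert.1 hb with rfl | hb
          · exact absurd hab (G.irrefl)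
          · exact absurd hab (hnv b hb)
        · rcases Finset.mem_insert.1 hb with rfl | hb
          · exact absurd hab.symm (hnv a haI)
          · exact ⟨a, haI, b, hb, hab⟩)
      exact ⟨x, hTS hx, y, hTS hy, z, hTS hz, h⟩

/-- The three vertices of a triangle, with the optional vertex in the middle. -/
def tripleList {V : Type*} (T : V × V × V) : List V := [T.1, T.2.2, T.2.1]

theorem SimpleGraph.exists_disjoint_triangles {V : Type*} [Fintype V] [DecidableEq V]
    {G : SimpleGraph V} (k m : ℕ) (hm : 3 * m + k ^ 2 ≤ Fintype.card V)
    (hind : ∀ I : Finset V, I.card = k → ∃ a ∈ I, ∃ b ∈ I, G.Adj a b) :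
    ∃ S : Finset (V × V × V), S.card = m ∧
      (∀ T ∈ S, G.Adj T.1 T.2.1 ∧ G.Adj T.2.1 T.2.2 ∧ G.Adj T.1 T.2.2) ∧
      ∀ T ∈ S, ∀ T' ∈ S, T ≠ T' → (tripleList T).Disjoint (tripleList T') := by
  induction m with
  | zero => exact ⟨∅, by simp⟩
  | succ m ih =>
    obtain ⟨S, hS, hadj, hdis⟩ := ih (by omega)
    set W : Finset V := S.biUnion fun T => (tripleList T).toFinset with hW
    have hWc : W.card ≤ m * 3 := hS ▸ Finset.card_biUnion_le_card_mul _ _ _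
      (fun T _ => (List.toFinset_card_le _).trans (by simp [tripleList]))
    have hWc' := Finset.card_compl W
    obtain ⟨x, hx, y, hy, z, hz, h1, h2, h3⟩ :=
      SimpleGraph.exists_triangle_of_sq_le_card (G := G) k Wᶜ (by omega) (fun I _ => hind I)
    have hnew : ∀ T ∈ S, (tripleList (x, y, z)).Disjoint (tripleList T) := by
      intro T hT v hv hvT
      have hvW : v ∈ W := Finset.mem_biUnion.2 ⟨T, hT, List.mem_toFinset.2 hvT⟩
      simp only [tripleList, List.mem_cons, List.not_mem_nil, or_false] at hv
      rw [Finset.mem_compl] at hx hy hz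
      rcases hv with rfl | rfl | rfl <;> contradiction
    have hnot : (x, y, z) ∉ S := fun h =>
      hnew _ h (a := x) (by simp [tripleList]) (by simp [tripleList])
    refine ⟨insert (x, y, z) S, by rw [Finset.card_insert_of_notMem hnot, hS], ?_, ?_⟩
    · intro T hT
      rcases Finset.mem_insert.1 hT with rfl | hT
      · exact ⟨h1, h2, h3⟩
      · exact hadj T hT
    · intro T hT T' hT' hne
      rcases Finset.mem_insert.1 hT with rfl | hT <;> rcases Finset.mem_insert.1 hT' with rfl | hT'
      · exact absurd rfl hne
      · exact hnew T' hT'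
      · exact (hnew T hT).symm
      · exact hdis T hT T' hT' hne

theorem SimpleGraph.exists_chain_of_triangle_chain {V : Type*} {G : SimpleGraph V}
    (l : List (V × V × V))
    (hadj : ∀ T ∈ l, G.Adj T.1 T.2.1 ∧ G.Adj T.2.1 T.2.2 ∧ G.Adj T.1 T.2.2)
    (hc : l.IsChain fun T T' => G.Adj T.2.1 T'.1) (n : ℕ) (h2 : 2 * l.length ≤ n)
    (h3 : n ≤ 3 * l.length) :
    ∃ w : List V, w.Sublist (l.flatMap tripleList) ∧ w.IsChain G.Adj ∧ w.length = n ∧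
      w.head? = l.head?.map (fun T => T.1) ∧ w.getLast? = l.getLast?.map (fun T => T.2.1) := by
  induction l generalizing n with
  | nil => exact ⟨[], by simp_all⟩
  | cons T l ih =>
    simp only [List.length_cons] at h2 h3
    have hT := hadj T (by simp)
    have hlink : ∀ w : List V, w.head? = l.head?.map (fun T => T.1) →
        ∀ x ∈ w.head?, G.Adj T.2.1 x := by
      intro w hw x hx
      rw [hw] at hx
      obtain ⟨T', hT', rfl⟩ := Option.map_eq_some_iff.1 hx
      exact (List.isChain_cons.1 hc).1 T' hT'
    have hlast : ∀ w : List V, w.getLast? = l.getLast?.map (fun T => T.2.1) → ∀ u : List V,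
        (u ++ T.2.1 :: w).getLast? = (T :: l).getLast?.map (fun T => T.2.1) := by
      intro w hw u
      rw [List.getLast?_append, List.getLast?_cons, List.getLast?_cons, hw]
      cases l.getLast? <;> simp
    -- Use the third vertex as long as the remaining triangles can still absorb two vertices each.
    by_cases hn : 2 * l.length ≤ n - 3 ∧ 3 ≤ n
    · obtain ⟨w, hsub, hch, hlen, hhead, hl⟩ := ih (fun T hT => hadj T (List.mem_cons_of_mem _ hT))
        hc.tail (n - 3) hn.1 (by omega)
      refine ⟨T.1 :: T.2.2 :: T.2.1 :: w, ?_, ?_, ?_, by simp, hlast w hl [T.1, T.2.2]⟩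
      · simpa [tripleList] using hsub
      · simp only [List.isChain_cons_cons]
        exact ⟨hT.2.2, hT.2.1.symm, List.isChain_cons.2 ⟨hlink w hhead, hch⟩⟩
      · simp; omega
    · obtain ⟨w, hsub, hch, hlen, hhead, hl⟩ := ih (fun T hT => hadj T (List.mem_cons_of_mem _ hT))
        hc.tail (n - 2) (by omega) (by omega)
      refine ⟨T.1 :: T.2.1 :: w, ?_, ?_, ?_, by simp, hlast w hl [T.1]⟩
      · exact ((hsub.cons_cons T.2.1).cons T.2.2).cons_cons T.1
      · simp only [List.isChain_cons_cons]
        exact ⟨hT.1, List.isChain_cons.2 ⟨hlink w hhead, hch⟩⟩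
      · simp; omega

theorem SimpleGraph.cycleGraph_isContained_of_joined {V : Type*} [Fintype V] [DecidableEq V]
    {G : SimpleGraph V} (n k : ℕ) (hn : 20 * k + 20 ≤ n)
    (hV : 3 * (n / 2 + 4 * k) + k ^ 2 ≤ Fintype.card V)
    (hind : ∀ I : Finset V, I.card = k → ∃ a ∈ I, ∃ b ∈ I, G.Adj a b)
    (hjoin : ∀ X Y : Finset V, Disjoint X Y → X.card = k → Y.card = k →
      ∃ x ∈ X, ∃ y ∈ Y, G.Adj x y) : (cycleGraph n).IsContained G := by
  obtain ⟨S, hS, hadj, hdis⟩ := SimpleGraph.exists_disjoint_triangles k (n / 2 + 4 * k) hV hind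
  have hmem1 : ∀ T : V × V × V, T.1 ∈ tripleList T := fun T => by simp [tripleList]
  have hmem2 : ∀ T : V × V × V, T.2.1 ∈ tripleList T := fun T => by simp [tripleList]
  have hR : ∀ X ⊆ S, ∀ Y ⊆ S, Disjoint X Y → X.card = k → Y.card = k →
      ∃ T ∈ X, ∃ T' ∈ Y, G.Adj T.2.1 T'.1 := by
    intro X hX Y hY hXY hXc hYc
    obtain ⟨x, hx, y, hy, hxy⟩ := hjoin (X.image fun T => T.2.1) (Y.image fun T => T.1) (by
      rw [Finset.disjoint_left]
      intro v hv hv'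
      obtain ⟨T, hT, rfl⟩ := Finset.mem_image.1 hv
      obtain ⟨T', hT', h⟩ := Finset.mem_image.1 hv'
      exact hdis T (hX hT) T' (hY hT') (fun e => Finset.disjoint_left.1 hXY hT (e ▸ hT'))
        (hmem2 T) (h ▸ hmem1 T')) (by
      rw [Finset.card_image_of_injOn, hXc]
      intro T hT T' hT' h
      by_contra hne
      exact hdis T (hX hT) T' (hX hT') hne (hmem2 T) (by rw [show T.2.1 = T'.2.1 from h]; exact hmem2 T')) (by
      rw [Finset.card_image_of_injOn, hYc]
      intro T hT T' hT' h
      by_contra hne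
      exact hdis T (hY hT) T' (hY hT') hne (hmem1 T) (by rw [show T.1 = T'.1 from h]; exact hmem1 T'))
    obtain ⟨T, hT, rfl⟩ := Finset.mem_image.1 hx
    obtain ⟨T', hT', rfl⟩ := Finset.mem_image.1 hy
    exact ⟨T, hT, T', hT', hxy⟩
  obtain ⟨l, hc, hnd, hlS, hlen⟩ := exists_long_chain_of_joined _ S k hR
  have hflat : (l.flatMap tripleList).Nodup := by
    rw [List.nodup_flatMap]
    refine ⟨fun T hT => ?_, hnd.pairwise_of_forall_ne fun T hT T' hT' hne => hdis T (hlS T hT) T' (hlS T' hT') hne⟩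
    obtain ⟨h1, h2, h3⟩ := hadj T (hlS T hT)
    simp [tripleList, h1.ne, h2.ne', h3.ne]
  -- The closing edge runs from `l₃` back to `l₁`. Wherever its ends lie, the enclosed segment has
  -- between `n/2 - 2k` and `n/2 - 2` triangles, so `n` is between two and three times its length.
  obtain ⟨l₁, l₂, l₃, l₄, rfl, h1, h2, h3⟩ : ∃ l₁ l₂ l₃ l₄, l = l₁ ++ (l₂ ++ (l₃ ++ l₄)) ∧
      l₁.length = k ∧ l₂.length = n / 2 - 2 * k - 2 ∧ l₃.length = k := by
    refine ⟨l.take k, (l.drop k).take (n / 2 - 2 * k - 2), ((l.drop k).drop (n / 2 - 2 * k - 2)).take k,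
      ((l.drop k).drop (n / 2 - 2 * k - 2)).drop k, by simp only [List.take_append_drop], ?_, ?_, ?_⟩ <;>
    simp only [List.length_take, List.length_drop] <;> omega
  have hd3 : Disjoint l₃.toFinset l₁.toFinset := by
    rw [Finset.disjoint_left]
    intro T h h'
    rw [List.mem_toFinset] at h h'
    exact (List.nodup_append'.1 hnd).2.2 h' (by simp [h])
  obtain ⟨b, hb, a, ha, hab⟩ := hR l₃.toFinset
    (fun T hT => hlS T (by simp [List.mem_toFinset.1 hT])) l₁.toFinset
    (fun T hT => hlS T (by simp [List.mem_toFinset.1 hT])) hd3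
    (by rw [List.toFinset_card_of_nodup, h3]
        exact hnd.sublist (((List.sublist_append_left _ _).trans (List.sublist_append_right _ _)).trans
          (List.sublist_append_right _ _)))
    (by rw [List.toFinset_card_of_nodup, h1]
        exact hnd.sublist (List.sublist_append_left _ _))
  obtain ⟨p, q, rfl⟩ := List.append_of_mem (List.mem_toFinset.1 ha)
  obtain ⟨p', q', rfl⟩ := List.append_of_mem (List.mem_toFinset.1 hb)
  have hinf : (a :: q ++ l₂ ++ p' ++ [b]) <:+: ((p ++ a :: q) ++ (l₂ ++ ((p' ++ b :: q') ++ l₄))) :=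
    ⟨p, q' ++ l₄, by simp⟩
  simp only [List.length_append, List.length_cons] at h1 h3
  obtain ⟨w, hsub, hch, hwlen, hhead, hlast⟩ := SimpleGraph.exists_chain_of_triangle_chain
    (a :: q ++ l₂ ++ p' ++ [b]) (fun T hT => hadj T (hlS T (hinf.subset hT))) (hc.infix hinf) n
    (by simp; omega) (by simp; omega)
  refine cycleGraph_isContained_of_list hwlen
    (hflat.sublist (hsub.trans (hinf.sublist.flatMap tripleList))) hch ?_
  intro x hx y hy
  rw [hhead] at hx
  rw [hlast, List.getLast?_append] at hy
  obtain rfl : a.1 = x := by simpa using hx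
  obtain rfl : b.2.1 = y := by simpa using hy
  exact hab

/-! ### The case of two unjoined sets -/

theorem List.exists_alternating_chain {V : Type*} {R : V → V → Prop} (as bs : List V)
    (h : as.length = bs.length) (hR : ∀ a ∈ as, ∀ b ∈ bs, R a b ∧ R b a) :
    ∃ w : List V, w.Perm (as ++ bs) ∧ w.IsChain R ∧ w.head? = as.head? ∧
      w.getLast? = bs.getLast? := by
  induction as generalizing bs with
  | nil =>
    obtain rfl : bs = [] := List.length_eq_zero_iff.1 h.symm
    exact ⟨[], by simp⟩
  | cons a as ih =>
    cases bs with
    | nil => simp at h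
    | cons b bs =>
      obtain ⟨w, hp, hc, hh, hl⟩ := ih bs (by simpa using h)
        fun x hx y hy => hR x (by simp [hx]) y (by simp [hy])
      refine ⟨a :: b :: w, ?_, ?_, by simp, ?_⟩
      · refine List.Perm.cons a ?_
        exact (hp.cons b).trans List.perm_middle.symm
      · refine List.isChain_cons_cons.2 ⟨(hR a (by simp) b (by simp)).1, List.isChain_cons.2 ⟨?_, hc⟩⟩
        intro x hx
        rw [hh] at hx
        exact (hR x (List.mem_cons_of_mem _ (List.mem_of_mem_head? hx)) b (by simp)).2
      · rw [List.getLast?_cons, List.getLast?_cons, List.getLast?_cons, hl]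
        simp

theorem Finset.exists_list_of_mem {V : Type*} [DecidableEq V] {A : Finset V} {a : V} (ha : a ∈ A)
    {t : ℕ} (ht : t + 1 ≤ A.card) :
    ∃ l : List V, l.length = t ∧ (a :: l).Nodup ∧ ∀ x ∈ a :: l, x ∈ A := by
  have h := Finset.card_erase_add_one ha
  refine ⟨(A.erase a).toList.take t, ?_, ?_, ?_⟩
  · simp; omega
  · refine List.nodup_cons.2 ⟨fun h => ?_, (Finset.nodup_toList _).sublist (List.take_sublist _ _)⟩
    have := List.mem_of_mem_take h
    simp at this
  · intro x hx
    rcases List.mem_cons.1 hx with rfl | hx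
    · exact ha
    · have := List.mem_of_mem_take hx
      simp at this
      exact this.2

theorem SimpleGraph.cycleGraph_isContained_of_odd {V : Type*} [DecidableEq V] {H : SimpleGraph V}
    {A B : Finset V} (hAB : Disjoint A B) (hH : ∀ a ∈ A, ∀ b ∈ B, H.Adj a b) {t : ℕ}
    (hA : t + 1 ≤ A.card) (hB : t + 1 ≤ B.card) {v a b : V} (hvA : v ∉ A) (hvB : v ∉ B)
    (ha : a ∈ A) (hb : b ∈ B) (hva : H.Adj v a) (hvb : H.Adj v b) :
    (cycleGraph (2 * (t + 1) + 1)).IsContained H := by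
  obtain ⟨as, has, hand, haA⟩ := Finset.exists_list_of_mem ha hA
  obtain ⟨bs, hbs, hbnd, hbB⟩ := Finset.exists_list_of_mem hb hB
  have hbB' : ∀ x ∈ (b :: bs).reverse, x ∈ B := fun x hx => hbB x (List.mem_reverse.1 hx)
  -- Reversing the second list makes the alternating path end at `b`, ready to be closed through
  -- `v`.
  obtain ⟨w, hp, hc, hh, hl⟩ := List.exists_alternating_chain (R := H.Adj) (a :: as)
    (b :: bs).reverse (by simp [has, hbs])
    fun x hx y hy => ⟨hH x (haA x hx) y (hbB' y hy), (hH x (haA x hx) y (hbB' y hy)).symm⟩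
  refine cycleGraph_isContained_of_list (l := v :: w) ?_ ?_ ?_ ?_
  · rw [List.length_cons, hp.length_eq]; simp [has, hbs]; omega
  · refine List.nodup_cons.2 ⟨fun h => ?_, hp.nodup_iff.2 ?_⟩
    · rcases List.mem_append.1 (hp.subset h) with h | h
      · exact hvA (haA v h)
      · exact hvB (hbB' v h)
    · refine List.nodup_append'.2 ⟨hand, List.nodup_reverse.2 hbnd, ?_⟩
      intro x hx hx'
      exact Finset.disjoint_left.1 hAB (haA x hx) (hbB' x hx')
  · refine List.isChain_cons.2 ⟨?_, hc⟩
    intro x hx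
    rw [hh] at hx
    simp at hx
    exact hx ▸ hva
  · intro x hx y hy
    rw [List.getLast?_cons, hl] at hy
    simp at hx hy
    subst hx hy
    exact hvb.symm

/-- Add vertices as singleton paths. Once there are `k + 1` paths, two of their heads are adjacent,
and reversing one path merges the two. -/
theorem SimpleGraph.exists_path_cover {V : Type*} [DecidableEq V] {G : SimpleGraph V} (k : ℕ)
    (hind : ∀ I : Finset V, I.card = k + 1 → ∃ a ∈ I, ∃ b ∈ I, G.Adj a b) (X : Finset V) :
    ∃ L : List (List V), (∀ l ∈ L, l ≠ [] ∧ l.IsChain G.Adj) ∧ L.length ≤ k ∧ L.flatten.Nodup ∧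
      ∀ v, v ∈ L.flatten ↔ v ∈ X := by
  induction X using Finset.induction_on with
  | empty => exact ⟨[], by simp⟩
  | insert v X hv ih =>
    obtain ⟨L, hL, hlen, hnd, hmem⟩ := ih
    have hL' : ∀ l ∈ [v] :: L, l ≠ [] ∧ l.IsChain G.Adj := by
      intro l hl
      rcases List.mem_cons.1 hl with rfl | hl
      · simp
      · exact hL l hl
    have hnd' : ([v] :: L).flatten.Nodup := by
      rw [List.flatten_cons, List.singleton_append, List.nodup_cons, hmem]
      exact ⟨hv, hnd⟩
    have hmem' : ∀ u, u ∈ ([v] :: L).flatten ↔ u ∈ insert v X := by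
      intro u
      rw [List.flatten_cons, List.singleton_append, List.mem_cons, hmem, Finset.mem_insert]
    have hlen' : ([v] :: L).length ≤ k + 1 := by simpa using hlen
    generalize ([v] :: L) = M at hL' hnd' hmem' hlen'
    rcases Nat.lt_or_ge k M.length with hk | hk
    swap
    · exact ⟨M, hL', hk, hnd', hmem'⟩
    have hpair : ¬ M.Pairwise fun l m => ∀ a ∈ l.head?, ∀ b ∈ m.head?, ¬ G.Adj a b := by
      intro hP
      have hsubl : ∀ N : List (List V), (∀ l ∈ N, l ≠ []) →
          (N.filterMap List.head?).length = N.length ∧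
            (N.filterMap List.head?).Sublist N.flatten := by
        intro N hN
        induction N with
        | nil => simp
        | cons l N ih =>
          obtain ⟨h1, h2⟩ := ih fun m hm => hN m (by simp [hm])
          cases l with
          | nil => exact absurd rfl (hN [] (by simp))
          | cons a l =>
            refine ⟨by simp [h1], ?_⟩
            simpa using h2.trans (List.sublist_append_right l _)
      obtain ⟨h1, h2⟩ := hsubl M fun l hl => (hL' l hl).1
      have hhnd := hnd'.sublist h2
      obtain ⟨a, ha, b, hb, hab⟩ := hind (M.filterMap List.head?).toFinset (by
        rw [List.toFinset_card_of_nodup hhnd, h1]; omega)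
      rw [List.mem_toFinset] at ha hb
      have hP' : (M.filterMap List.head?).Pairwise fun a b => ¬ G.Adj a b :=
        List.pairwise_filterMap.2 (hP.imp fun h a ha b hb => h a ha b hb)
      exact @List.Pairwise.forall _ _ _ ⟨fun _ _ h h' => h h'.symm⟩ hP' a ha b hb hab.ne hab
    rw [List.pairwise_iff_forall_sublist] at hpair
    push Not at hpair
    obtain ⟨l, m, hlm, a, ha, b, hb, hab⟩ := hpair
    obtain ⟨M', hM'⟩ := hlm.exists_perm_append
    have hperm : ((l.reverse ++ m) :: M').flatten.Perm M.flatten := by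
      refine List.Perm.trans ?_ hM'.flatten.symm
      simp only [List.flatten_cons, List.cons_append, List.nil_append, List.append_assoc]
      exact (List.reverse_perm l).append_right _
    have hlM := hL' l (hM'.symm.subset (by simp))
    have hmM := hL' m (hM'.symm.subset (by simp))
    refine ⟨(l.reverse ++ m) :: M', ?_, ?_, hperm.nodup_iff.2 hnd', fun u => hperm.mem_iff.trans (hmem' u)⟩
    · intro p hp
      rcases List.mem_cons.1 hp with rfl | hp
      · refine ⟨by simp [hmM.1], List.isChain_append.2 ⟨?_, hmM.2, ?_⟩⟩
        · rw [List.isChain_reverse]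
          exact hlM.2.imp fun _ _ h => h.symm
        · intro x hx y hy
          rw [List.getLast?_reverse] at hx
          rw [Option.mem_unique hx ha, Option.mem_unique hy hb]
          exact hab
      · exact hL' p (hM'.symm.subset (by simp [hp]))
    · have := hM'.length_eq
      simp at this ⊢
      omega

/-- Vertices of `as` alternate with whole paths of `L`; surplus ones follow each other, being
pairwise adjacent. Starting in `as` is what later allows closing the cycle. -/
theorem SimpleGraph.exists_chain_of_path_cover {V : Type*} {G : SimpleGraph V} (as : List V)
    (L : List (List V)) (hL : ∀ l ∈ L, l.IsChain G.Adj) (hlen : L.length ≤ as.length)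
    (hnd : as.Nodup) (has : ∀ a ∈ as, ∀ b ∈ as, a ≠ b → G.Adj a b)
    (haL : ∀ a ∈ as, ∀ v ∈ L.flatten, G.Adj a v) :
    ∃ w : List V, w.Perm (as ++ L.flatten) ∧ w.IsChain G.Adj ∧ w.head? = as.head? := by
  induction as generalizing L with
  | nil =>
    obtain rfl : L = [] := List.length_eq_zero_iff.1 (by simpa using hlen)
    exact ⟨[], by simp⟩
  | cons a as ih =>
    rw [List.nodup_cons] at hnd
    obtain ⟨w, hp, hc, hh⟩ := ih L.tail (fun l hl => hL l (List.mem_of_mem_tail hl))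
      (by simp at hlen ⊢; omega) hnd.2
      (fun x hx y hy => has x (by simp [hx]) y (by simp [hy]))
      (fun x hx y hy => haL x (by simp [hx]) y (by
        obtain ⟨l, hl, hy⟩ := List.mem_flatten.1 hy
        exact List.mem_flatten.2 ⟨l, List.mem_of_mem_tail hl, hy⟩))
    have hwas : ∀ x ∈ w.head?, x ∈ as := fun x hx => List.mem_of_mem_head? (hh ▸ hx)
    cases L with
    | nil =>
      refine ⟨a :: w, by simpa using hp, List.isChain_cons.2 ⟨fun x hx => ?_, hc⟩, by simp⟩
      exact has a (by simp) x (by simp [hwas x hx]) fun e => hnd.1 (e ▸ hwas x hx)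
    | cons l L =>
      refine ⟨a :: (l ++ w), ?_, ?_, by simp⟩
      · refine List.Perm.cons a ?_
        refine (hp.append_left l).trans ?_
        simp only [List.tail_cons, List.flatten_cons]
        rw [← List.append_assoc]
        refine (List.perm_append_comm.append_right _).trans ?_
        rw [List.append_assoc]
        exact List.Perm.refl _
      · refine List.isChain_cons.2 ⟨fun x hx => ?_, List.isChain_append.2 ⟨hL l (by simp), hc, ?_⟩⟩
        · have hx' := List.mem_of_mem_head? hx
          rcases List.mem_append.1 hx' with h | h
          · exact haL a (by simp) x (by simp [h])
          · rcases List.mem_append.1 (hp.subset h) with h | h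
            · exact has a (by simp) x (by simp [h]) fun e => hnd.1 (e ▸ h)
            · exact haL a (by simp) x (by simp at h ⊢; tauto)
        · intro x hx y hy
          exact (haL y (by simp [hwas y hy]) x (by simp [List.mem_of_mem_getLast? hx])).symm

theorem SimpleGraph.cycleGraph_isContained_of_universal_clique {V : Type*} [DecidableEq V]
    {G : SimpleGraph V} {n k : ℕ} (hn : 3 ≤ n) (A X : Finset V)
    (hA : A.card = k + 1) (hX : n ≤ A.card + X.card) (hkn : k + 1 ≤ n)
    (hAA : ∀ a ∈ A, ∀ b ∈ A, a ≠ b → G.Adj a b) (hAX : ∀ a ∈ A, ∀ x ∈ X, G.Adj a x)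
    (hind : ∀ I : Finset V, I.card = k + 1 → ∃ a ∈ I, ∃ b ∈ I, G.Adj a b) :
    (cycleGraph n).IsContained G := by
  obtain ⟨Y, hYX, hY⟩ := Finset.exists_subset_card_eq (show n - A.card ≤ X.card by omega)
  obtain ⟨L, hL, hlen, hnd, hmem⟩ := SimpleGraph.exists_path_cover k hind Y
  have hLY : ∀ a ∈ A, ∀ v ∈ L.flatten, G.Adj a v :=
    fun a ha v hv => hAX a ha v (hYX ((hmem v).1 hv))
  obtain ⟨w, hp, hc, hh⟩ := SimpleGraph.exists_chain_of_path_cover (G := G) A.toList L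
    (fun l hl => (hL l hl).2) (by simp; omega) A.nodup_toList (by simpa using hAA)
    (by simpa using hLY)
  have hLlen : L.flatten.length = n - A.card := by
    rw [← hY, ← List.toFinset_card_of_nodup hnd]
    congr 1
    ext v
    rw [List.mem_toFinset, hmem]
  have hwl : w.length = n := by
    rw [hp.length_eq, List.length_append, hLlen, Finset.length_toList]; omega
  have hwnd : w.Nodup := hp.nodup_iff.2 (List.nodup_append'.2 ⟨A.nodup_toList, hnd, by
    intro v hv hv'
    exact G.irrefl (hLY v (by simpa using hv) v hv')⟩)
  refine cycleGraph_isContained_of_list hwl hwnd hc ?_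
  intro x hx y hy
  have hxA : x ∈ A := Finset.mem_toList.1 (List.mem_of_mem_head? (hh ▸ hx))
  have hne : x ≠ y := by
    rintro rfl
    cases w with
    | nil => simp at hx
    | cons u w =>
      simp at hx
      subst hx
      have hw : w ≠ [] := by rintro rfl; simp at hwl; omega
      rw [List.getLast?_cons, List.getLast?_eq_some_getLast hw] at hy
      simp at hy
      exact (List.nodup_cons.1 hwnd).1 (hy ▸ List.getLast_mem hw)
  rcases List.mem_append.1 (hp.subset (List.mem_of_mem_getLast? hy)) with h | h
  · exact (hAA x hxA y (by simpa using h) hne).symm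
  · exact (hLY x hxA y h).symm

theorem SimpleGraph.cycleGraph_isContained_of_not_joined {V : Type*} [Fintype V] [DecidableEq V]
    {G : SimpleGraph V} {n t : ℕ} (hn : 2 * (t + 1) + 1 ≤ n) (hV : 2 * n - 1 ≤ Fintype.card V)
    (hfree : ¬ (cycleGraph (2 * (t + 1) + 1)).IsContained Gᶜ)
    (hind : ∀ I : Finset V, I.card = 2 * (t + 1) + 1 → ∃ a ∈ I, ∃ b ∈ I, G.Adj a b)
    {A B : Finset V} (hAB : Disjoint A B) (hA : A.card = 2 * (t + 1) + 1)
    (hB : B.card = 2 * (t + 1) + 1) (hno : ∀ a ∈ A, ∀ b ∈ B, ¬ G.Adj a b) :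
    (cycleGraph n).IsContained G := by
  classical
  have hblue : ∀ a ∈ A, ∀ b ∈ B, Gᶜ.Adj a b := fun a ha b hb =>
    (G.compl_adj a b).2 ⟨fun e => Finset.disjoint_left.1 hAB ha (e ▸ hb), hno a ha b hb⟩
  -- Here `v` may lie in `A` or `B`, hence the erasures below; that case is what makes `A` and `B`
  -- cliques.
  have key : ∀ v a b, a ∈ A → b ∈ B → v ≠ a → v ≠ b → G.Adj v a ∨ G.Adj v b := by
    intro v a b ha hb hva hvb
    by_contra! h
    refine hfree (cycleGraph_isContained_of_odd (A := A.erase v) (B := B.erase v) (v := v) (a := a)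
      (b := b) ?_ ?_ ?_ ?_ ?_ ?_ ?_ ?_ ?_ ?_)
    · exact Finset.disjoint_of_subset_left (Finset.erase_subset _ _)
        (Finset.disjoint_of_subset_right (Finset.erase_subset _ _) hAB)
    · exact fun x hx y hy => hblue x (Finset.mem_of_mem_erase hx) y (Finset.mem_of_mem_erase hy)
    · have := Finset.pred_card_le_card_erase (s := A) (a := v); omega
    · have := Finset.pred_card_le_card_erase (s := B) (a := v); omega
    · simp
    · simp
    · exact Finset.mem_erase.2 ⟨hva.symm, ha⟩
    · exact Finset.mem_erase.2 ⟨hvb.symm, hb⟩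
    · exact (G.compl_adj v a).2 ⟨hva, h.1⟩
    · exact (G.compl_adj v b).2 ⟨hvb, h.2⟩
  obtain ⟨a₀, ha₀⟩ := Finset.card_pos.1 (show 0 < A.card by omega)
  obtain ⟨b₀, hb₀⟩ := Finset.card_pos.1 (show 0 < B.card by omega)
  have hAA : ∀ a ∈ A, ∀ a' ∈ A, a ≠ a' → G.Adj a a' := fun a ha a' ha' hne =>
    (key a a' b₀ ha' hb₀ hne fun e => Finset.disjoint_left.1 hAB ha (e ▸ hb₀)).resolve_right
      (hno a ha b₀ hb₀)
  have hBB : ∀ b ∈ B, ∀ b' ∈ B, b ≠ b' → G.Adj b b' := fun b hb b' hb' hne =>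
    (key b a₀ b' ha₀ hb' (fun e => Finset.disjoint_left.1 hAB ha₀ (e ▸ hb)) hne).resolve_left
      fun h => hno a₀ ha₀ b hb h.symm
  set X := Finset.univ.filter fun v => ∀ a ∈ A, G.Adj a v with hX
  set Y := Finset.univ.filter fun v => ∀ b ∈ B, G.Adj b v with hY
  have hcover : Finset.univ ⊆ (A ∪ X) ∪ (B ∪ Y) := by
    intro v _
    simp only [Finset.mem_union, hX, hY, Finset.mem_filter, Finset.mem_univ, true_and]
    by_contra! h
    obtain ⟨⟨hvA, a, ha, hva⟩, hvB, b, hb, hvb⟩ := h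
    rcases key v a b ha hb (fun e => hvA (e ▸ ha)) (fun e => hvB (e ▸ hb)) with h | h
    · exact hva h.symm
    · exact hvb h.symm
  have hc := Finset.card_le_card hcover
  rw [Finset.card_univ] at hc
  have h1 := Finset.card_union_le (A ∪ X) (B ∪ Y)
  have h2 := Finset.card_union_le A X
  have h3 := Finset.card_union_le B Y
  -- The two sides cover at least `2n - 1` vertices, so they cannot both have fewer than `n`.
  rcases le_or_gt n (A.card + X.card) with h | h
  · exact cycleGraph_isContained_of_universal_clique (by omega) A X hA h hn hAA
      (fun a ha x hx => (Finset.mem_filter.1 hx).2 a ha) hind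
  · exact cycleGraph_isContained_of_universal_clique (by omega) B Y hB (by omega) hn hBB
      (fun a ha x hx => (Finset.mem_filter.1 hx).2 a ha) hind

/-! ### The upper bound -/

theorem SimpleGraph.exists_adj_of_cycleGraph_not_isContained_compl {V : Type*} {G : SimpleGraph V}
    {k : ℕ} (hfree : ¬ (cycleGraph k).IsContained Gᶜ) (I : Finset V)
    (hI : I.card = k) : ∃ a ∈ I, ∃ b ∈ I, G.Adj a b := by
  by_contra! h
  have hadj : ∀ x ∈ I, ∀ y ∈ I, x ≠ y → Gᶜ.Adj x y := fun x hx y hy hne =>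
    (G.compl_adj x y).2 ⟨hne, h x hx y hy⟩
  refine hfree ⟨⟨⟨fun i => (I.equivFinOfCardEq hI).symm i, fun {u v} huv => ?_⟩, ?_⟩⟩
  · exact hadj _ (Subtype.property _) _ (Subtype.property _) fun e =>
      huv.ne ((I.equivFinOfCardEq hI).symm.injective (Subtype.ext e))
  · exact fun u v e => (I.equivFinOfCardEq hI).symm.injective (Subtype.ext e)

theorem ramseyProperty_cycleGraph_odd {n t : ℕ} (hn : 50 * (2 * (t + 1) + 1) ^ 2 ≤ n) :
    RamseyProperty (cycleGraph n) (cycleGraph (2 * (t + 1) + 1)) (2 * n - 1) := by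
  intro G
  by_contra hcon
  obtain ⟨hG, hfree⟩ := not_or.1 hcon
  have hsq : 2 * (t + 1) + 1 ≤ (2 * (t + 1) + 1) ^ 2 := Nat.le_self_pow (by norm_num) _
  have hind := exists_adj_of_cycleGraph_not_isContained_compl hfree
  by_cases hj : ∀ X Y : Finset (Fin (2 * n - 1)), Disjoint X Y → X.card = 2 * (t + 1) + 1 →
      Y.card = 2 * (t + 1) + 1 → ∃ x ∈ X, ∃ y ∈ Y, G.Adj x y
  · refine hG (cycleGraph_isContained_of_joined n (2 * (t + 1) + 1) (by omega) ?_ hind hj)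
    rw [Fintype.card_fin]
    generalize (2 * (t + 1) + 1) ^ 2 = s at *
    omega
  · push Not at hj
    obtain ⟨A, B, hAB, hA, hB, hno⟩ := hj
    exact hG (cycleGraph_isContained_of_not_joined (by omega) (by simp) hfree hind hAB hA hB hno)

/-! ### The lower bound and the conclusion -/

theorem not_ramseyProperty_cycleGraph_odd {n k M : ℕ} (hk : 2 ≤ k) (hodd : Odd k)
    (hM : M < 2 * n - 1) : ¬ RamseyProperty (cycleGraph n) (cycleGraph k) M := by
  intro h
  let c : Fin M → Bool := fun i => decide (i.val < n - 1)
  let G : SimpleGraph (Fin M) :=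
    { Adj := fun i j => i ≠ j ∧ c i = c j
      symm := ⟨fun _ _ h => ⟨h.1.symm, h.2.symm⟩⟩
      loopless := ⟨fun _ h => h.1 rfl⟩ }
  rcases h G with ⟨⟨f⟩⟩ | ⟨⟨f⟩⟩
  · have hpos : 0 < n := by omega
    -- A cycle is connected, so its image stays inside one of the two cliques.
    have hconst : ∀ u v : Fin n, c (f u) = c (f v) := by
      intro u v
      obtain ⟨w⟩ := cycleGraph_preconnected u v
      induction w with
      | nil => rfl
      | cons hadj _ ih => exact (f.toHom.map_adj hadj).2.trans ih
    have hinj := f.injective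
    cases hc : c (f ⟨0, hpos⟩) with
    | true =>
      have hlt : ∀ u, (f u).val < n - 1 := fun u => by
        have := (hconst u ⟨0, hpos⟩).trans hc
        simpa [c] using this
      have := Fintype.card_le_of_injective (fun u => (⟨(f u).val, hlt u⟩ : Fin (n - 1)))
        fun u v e => hinj (Fin.ext (by simpa using e))
      simp at this
      omega
    | false =>
      have hge : ∀ u, n - 1 ≤ (f u).val := fun u => by
        have := (hconst u ⟨0, hpos⟩).trans hc
        simpa [c] using this
      have := Fintype.card_le_of_injective
        (fun u => (⟨(f u).val - (n - 1), by have := hge u; have := (f u).2; omega⟩ : Fin (n - 1)))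
        fun u v e => hinj (Fin.ext (by
          have h1 := hge u
          have h2 := hge v
          simp only [Fin.mk.injEq] at e
          change (f u).val = (f v).val
          omega))
      simp at this
      omega
  · have hcol : (cycleGraph k).Colorable 2 := by
      refine (Coloring.mk (fun u => c (f u)) ?_ : (cycleGraph k).Coloring Bool).colorable
      intro u v huv e
      have := (G.compl_adj _ _).1 (f.toHom.map_adj huv)
      exact this.2 ⟨this.1, e⟩
    have := hcol.chromaticNumber_le
    rw [chromaticNumber_cycleGraph_of_odd k hk hodd] at this
    exact absurd this (by decide)

theorem mainTheorem3 (n k : ℕ) (hk : 3 ≤ k) (hodd : Odd k) (hn : 1833 * k ^ 4 ≤ n) :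
    IsRamseyNumber (SimpleGraph.cycleGraph n) (SimpleGraph.cycleGraph k) (2 * n - 1) := by
  have hk4 : k ^ 2 ≤ k ^ 4 := Nat.pow_le_pow_right (by omega) (by norm_num)
  have hk2 : 1 ≤ k ^ 2 := Nat.one_le_pow _ _ (by omega)
  refine ⟨⟨by omega, ?_⟩, ?_⟩
  · obtain ⟨s, rfl⟩ := hodd
    obtain ⟨t, rfl⟩ : ∃ t, s = t + 1 := ⟨s - 1, by omega⟩
    exact ramseyProperty_cycleGraph_odd (by omega)
  · rintro M ⟨-, hM⟩
    by_contra! hlt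
    exact not_ramseyProperty_cycleGraph_odd (by omega) hodd hlt hM
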